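/- **Theorem (No-$\Phi$-regret with respect to RKHS deviations).** Let $\mathcal Z,\mathcal L\subseteq\mathbb R^d$ be convex and compact, $\mathcal L$ nonempty, let $\mathcal X$ be any set of contexts, and let $\sigma:\mathcal L\to\mathcal Z$ be a best-response map, i.e. $\sigma(p)\in\operatorname{argmin}_{z\in\mathcal Z}p^\top z$ for every $p$, with ties broken in an arbitrary fixed way. Let $\mathcal H$ be a vector-valued reproducing kernel Hilbert space of functions $\mathcal X\times\mathcal Z\to\mathbb R^d$ with matrix-valued kernel $\Gamma((x,z),(x',z'))\in\mathbb R^{d\times d}$, let $$\Phi=\{\phi\in\mathcal H:\ \phi(x,z)\in\mathcal Z\ \text{ for all } x\in\mathcal X,\ z\in\mathcal Z\},$$ and assume that $\rho:=\sup_{\phi\in\Phi}\|\phi\|_{\mathcal H}$ is finite (with $\rho := 0$ if $\Phi=\emptyset$). Define, for $(x,p),(x',p')\in\mathcal X\times\mathcal L$, $$\Gamma'((x,p),(x',p'))=\sigma(p)\sigma(p')^\top+\Gamma((x,\sigma(p)),(x',\sigma(p'))).$$ Defensive Forecasting with kernel $\Gamma'$, used as the loss forecaster of a decision maker, is the following procedure.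 In round $t=1,2,\dots$ Nature reveals $x_t\in\mathcal X$; the forecaster outputs, as a function of the past and of $x_t$, a finitely supported probability distribution $\mathcal D_t$ on $\mathcal L$ with $$\mathbb E_{p\sim\mathcal D_t}\big[S_t(p)^\top(y-p)\big]\le\epsilon_t=\tfrac1{10t^2}\quad\text{for all }y\in\mathcal L,\qquad S_t(p)=\sum_{i=1}^{t-1}\mathbb E_{p_i\sim\mathcal D_i}\big[\Gamma'((x_t,p),(x_i,p_i))(\ell_i-p_i)\big];$$ the decision maker plays the distribution $\mu_t$ of $z_t=\sigma(p_t)$, $p_t\sim\mathcal D_t$; then Nature reveals $\ell_t\in\mathcal L$. Such a $\mathcal D_t$ exists in every round, whatever happened before. Moreover, however these distributions are chosen, for all sequences $(x_t)$ in $\mathcal X$ and $(\ell_t)$ in $\mathcal L$ and every $T$, with $$V_T=\sum_{t=1}^T\mathbb E_{p_t\sim\mathcal D_t}\big[(p_t-\ell_t)^\top\Gamma'((x_t,p_t),(x_t,p_t))(p_t-\ell_t)\big],$$ the contextual $\Phi$-regret satisfies $$\sup_{\phi\in\Phi}\ \sum_{t=1}^T\mathbb E_{z_t\sim\mu_t}\big[\ell_t^\top(z_t-\phi(x_t,z_t))\big]\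 \le\ \sqrt{1+\rho^2}\,\sqrt{V_T+1}.$$ In particular it is $O\big(\rho\sqrt{V_T}\big)$ with an absolute constant: it is at most $2\rho\sqrt{V_T}$ whenever $\rho\ge1$ and $V_T\ge1$. -/

import Mathlib

namespace PhiRegret

noncomputable section

open Convexity (StdSimplex)
open scoped InnerProductSpace

/-- `ℝᵈ` with its Euclidean inner product. -/
abbrev Vec (d : ℕ) : Type := EuclideanSpace ℝ (Fin d)

/-- The expectation of `f` under a finitely supported probability distribution. -/
def expect {α M : Type*} [AddCommMonoid M] [Module ℝ M] (D : StdSimplex ℝ α) (f : α → M) : M :=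
  D.weights.sum fun a w => w • f a

/-- `σ` is a (single-valued) best-response map: `σ p ∈ argmin_{z ∈ Z} pᵀ z`, with ties broken
in an arbitrary but fixed way. -/
def IsBestResponse {d : ℕ} {Z L : Set (Vec d)} (σ : L → Z) : Prop :=
  ∀ p : L, ∀ z : Z, ⟪(p : Vec d), (σ p : Vec d)⟫_ℝ ≤ ⟪(p : Vec d), (z : Vec d)⟫_ℝ

/-- What happened in one round of online forecasting: the context, the distribution over
forecasts that was output, and the outcome. -/
structure Round (X Y : Type*) where
  context : X
  forecast : StdSimplex ℝ Y
  outcome : Y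

/-- An online forecaster: from the past rounds (oldest first) and the current context it
computes a distribution over forecasts. -/
abbrev Forecaster (X Y : Type*) : Type _ := List (Round X Y) → X → StdSimplex ℝ Y

/-- `D` solves the expected variational inequality of the operator `S` over `Y` to error `ε`:
`E_{p ∼ D} [S(p)ᵀ (y - p)] ≤ ε` for all `y ∈ Y`. -/
def SolvesEVI {d : ℕ} {Y : Set (Vec d)} (S : Y → Vec d) (ε : ℝ) (D : StdSimplex ℝ Y) : Prop :=
  ∀ y : Y, expect D (fun p : Y => ⟪S p, (y : Vec d) - (p : Vec d)⟫_ℝ) ≤ ε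

/-- The operator of Defensive Forecasting with matrix-valued kernel `K`:
`S(p) = ∑_i E_{q ∼ D_i} [K((x, p), (x_i, q)) (y_i - q)]`, summed over the past rounds. -/
def dfOperator {d : ℕ} {X : Type*} {Y : Set (Vec d)}
    (K : Matrix (X × Y) (X × Y) (Vec d →L[ℝ] Vec d)) (past : List (Round X Y)) (x : X) (p : Y) :
    Vec d :=
  (past.map fun r =>
    expect r.forecast fun q : Y =>
      K (x, p) (r.context, q) ((r.outcome : Vec d) - (q : Vec d))).sum

/-- `A` runs Defensive Forecasting with kernel `K`: in round `t` (so after `t - 1` past rounds)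
it outputs a solution of the EVI of the operator `dfOperator` to error `ε_t = 1 / (10 t²)`. -/
def IsDefensiveForecasting {d : ℕ} {X : Type*} {Y : Set (Vec d)}
    (K : Matrix (X × Y) (X × Y) (Vec d →L[ℝ] Vec d)) (A : Forecaster X Y) : Prop :=
  ∀ (past : List (Round X Y)) (x : X),
    SolvesEVI (dfOperator K past x) (1 / (10 * ((past.length : ℝ) + 1) ^ 2)) (A past x)

/-- The first `t` rounds when the forecaster `A` faces the contexts `x` and outcomes `y`
(rounds are numbered from `0`). -/
def history {X Y : Type*} (A : Forecaster X Y) (x : ℕ → X) (y : ℕ → Y) : ℕ → List (Round X Y)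
  | 0 => []
  | t + 1 => history A x y t ++ [⟨x t, A (history A x y t) (x t), y t⟩]

/-- The distribution `D_t` over forecasts output by `A` in round `t`. -/
def forecastAt {X Y : Type*} (A : Forecaster X Y) (x : ℕ → X) (y : ℕ → Y) (t : ℕ) :
    StdSimplex ℝ Y :=
  A (history A x y t) (x t)

/-- The reduction from multicalibration to `Φ`-regret: in round `t` the decision maker plays the
pushforward `μ_t` of the forecast distribution `D_t` under the best-response map, and the loss is
then fed back to the forecaster as the outcome. -/
def play {d : ℕ} {X : Type*} {Z L : Set (Vec d)} (σ : L → Z) (A : Forecaster X L)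
    (x : ℕ → X) (ℓ : ℕ → L) (t : ℕ) : StdSimplex ℝ Z :=
  (forecastAt A x ℓ t).map σ

/-- The contextual regret `∑_{t < T} E_{z ∼ μ_t} [ℓ_tᵀ (z - φ(x_t, z))]` against `φ`. -/
def contextualRegret {d : ℕ} {X : Type*} {Z L : Set (Vec d)} (μ : ℕ → StdSimplex ℝ Z)
    (x : ℕ → X) (ℓ : ℕ → L) (T : ℕ) (φ : X × Z → Vec d) : ℝ :=
  ∑ t ∈ Finset.range T,
    expect (μ t) fun z : Z => ⟪(ℓ t : Vec d), (z : Vec d) - φ (x t, z)⟫_ℝ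

section RKHS

variable {d : ℕ} {X : Type*} {Z L : Set (Vec d)} (H : Type*) [NormedAddCommGroup H]
  [InnerProductSpace ℝ H] [RKHS ℝ H (X × Z) (Vec d)]

/-- The members `φ` of the RKHS `H` with `φ (x, z) ∈ Z` for every context `x` and every `z ∈ Z`. -/
def endomorphisms : Set H := {φ : H | ∀ (x : X) (z : Z), φ (x, z) ∈ Z}

/-- `ρ = sup_{φ ∈ Φ} ‖φ‖_H`. -/
def endomorphismRadius : ℝ := sSup ((fun φ : H => ‖φ‖) '' endomorphisms H)

/-- The kernel
`Γ'((x, p), (x', p')) = σ(p) σ(p')ᵀ + Γ((x, σ(p)), (x', σ(p')))`, where `Γ` is the kernel of `H`. -/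
def forecastKernel [CompleteSpace H] (σ : L → Z) :
    Matrix (X × L) (X × L) (Vec d →L[ℝ] Vec d) :=
  fun a b => InnerProductSpace.rankOne ℝ (σ a.2 : Vec d) (σ b.2 : Vec d) +
    RKHS.kernel H (a.1, σ a.2) (b.1, σ b.2)

/-- The contextual `Φ`-regret: the supremum of the contextual regret over the endomorphisms in
`H`, taken in the extended reals. -/
def phiRegret (μ : ℕ → StdSimplex ℝ Z) (x : ℕ → X) (ℓ : ℕ → L) (T : ℕ) : EReal :=
  ⨆ φ ∈ endomorphisms H, ((contextualRegret μ x ℓ T φ : ℝ) : EReal)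

end RKHS

/-- `∑_{t < T} E_{p ∼ D_t} [(p - ℓ_t)ᵀ K((x_t, p), (x_t, p)) (p - ℓ_t)]`. -/
def kernelVariation {d : ℕ} {X : Type*} {L : Set (Vec d)}
    (K : Matrix (X × L) (X × L) (Vec d →L[ℝ] Vec d)) (D : ℕ → StdSimplex ℝ L)
    (x : ℕ → X) (ℓ : ℕ → L) (T : ℕ) : ℝ :=
  ∑ t ∈ Finset.range T, expect (D t) fun p : L =>
    ⟪(p : Vec d) - (ℓ t : Vec d), K (x t, p) (x t, p) ((p : Vec d) - (ℓ t : Vec d))⟫_ℝ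

end

end PhiRegret

/-! Γ' is the Gram kernel of a feature map Ψ into ℝ ⊕ H, with Ψ(x,p)v = (σ(p)ᵀv, Γ(·,(x,σ(p)))v).
Let G be the sum over rounds of E[Ψ(x_t,p)(ℓ_t - p)]. By the reproducing property, pairing G with
(1, -φ) gives the sum of E[(ℓ_t - p)ᵀ(σ(p) - φ(x_t,σ(p)))]. This dominates the regret, because σ(p)
minimises pᵀz and so beats φ(x_t,σ(p)) ∈ Z (`contextualRegret_le_inner`). Cauchy–Schwarz then leaves
‖G‖ to bound. When ‖G‖² is expanded round by round, each cross term is at most ε_t by the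
variational inequality at y = ℓ_t, and the squares add up to at most V_T by Jensen
(`norm_liftedResidual_sq_le`).

The distributions D_t exist by minimax (`exists_solvesEVI`): the point mass at y answers y, and
Sion's theorem turns such answers into one mixture good against every y. -/

namespace PhiRegret

open Convexity (StdSimplex)
open scoped InnerProductSpace

section Expectation

variable {α β M N : Type*} [AddCommGroup M] [Module ℝ M] [AddCommGroup N] [Module ℝ N]

lemma expect_eq_sum (D : StdSimplex ℝ α) (f : α → M) :
    expect D f = ∑ a ∈ D.weights.support, D.weights a • f a := rfl

@[simp]
lemma expect_const (D : StdSimplex ℝ α) (m : M) : expect D (fun _ => m) = m := by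
  have h : ∑ a ∈ D.weights.support, D.weights a = 1 := D.total
  rw [expect_eq_sum, ← Finset.sum_smul, h, one_smul]

lemma map_expect (D : StdSimplex ℝ α) (T : M →ₗ[ℝ] N) (f : α → M) :
    T (expect D f) = expect D fun a => T (f a) := by
  simp [expect_eq_sum, map_sum]

lemma expect_add (D : StdSimplex ℝ α) (f g : α → M) :
    expect D (fun a => f a + g a) = expect D f + expect D g := by
  simp [expect_eq_sum, smul_add, Finset.sum_add_distrib]

lemma expect_mono (D : StdSimplex ℝ α) {f g : α → ℝ} (h : ∀ a, f a ≤ g a) :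
    expect D f ≤ expect D g :=
  Finset.sum_le_sum fun a _ => mul_le_mul_of_nonneg_left (h a) (D.nonneg a)

@[simp]
lemma expect_single (a : α) (f : α → M) : expect (StdSimplex.single (R := ℝ) a) f = f a := by
  simp [expect]

lemma expect_map (D : StdSimplex ℝ α) (g : α → β) (f : β → M) :
    expect (D.map g) f = expect D fun a => f (g a) := by
  simp [expect, Finsupp.sum_mapDomain_index, add_smul]

/-- Mixing two distributions mixes their expectations. This supplies the convex strategy set for
Sion's theorem. -/
lemma convex_range_expect (f : α → M) :
    Convex ℝ (Set.range fun D : StdSimplex ℝ α => expect D f) := by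
  classical
  rintro _ ⟨D, rfl⟩ _ ⟨D', rfl⟩ s t hs ht hst
  refine ⟨Convexity.convexCombPair s t hs ht hst D D', ?_⟩
  simp only [expect, Convexity.StdSimplex.weights_convexCombPair]
  rw [Finsupp.sum_add_index' (by simp) (by simp [add_smul]), Finsupp.sum_smul_index (by simp),
    Finsupp.sum_smul_index (by simp)]
  simp [Finsupp.smul_sum, mul_smul]

end Expectation

section InnerProduct

variable {α F : Type*} [NormedAddCommGroup F] [InnerProductSpace ℝ F]

lemma inner_expect (D : StdSimplex ℝ α) (v : F) (f : α → F) :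
    ⟪v, expect D f⟫_ℝ = expect D fun a => ⟪v, f a⟫_ℝ :=
  map_expect D (innerₗ F v) f

/-- Jensen's inequality for the squared norm. -/
lemma norm_expect_sq_le (D : StdSimplex ℝ α) (f : α → F) :
    ‖expect D f‖ ^ 2 ≤ expect D fun a => ‖f a‖ ^ 2 := by
  -- With m the mean, 2⟪m, f a⟫ ≤ ‖m‖² + ‖f a‖²; averaging over a makes the left side 2‖m‖².
  have h : ∀ a, ⟪expect D f, f a⟫_ℝ + ⟪expect D f, f a⟫_ℝ ≤ ‖expect D f‖ ^ 2 + ‖f a‖ ^ 2 := fun a => by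
    have := norm_sub_sq_real (expect D f) (f a)
    nlinarith [sq_nonneg ‖expect D f - f a‖]
  have h' := expect_mono D h
  rw [expect_add, expect_add, expect_const, ← inner_expect, real_inner_self_eq_norm_sq] at h'
  linarith

end InnerProduct

/-- Expected variational inequalities over a nonempty compact convex set have solutions to every
positive error, for arbitrary (possibly discontinuous and unbounded) operators. -/
theorem exists_solvesEVI {d : ℕ} {Y : Set (Vec d)} (hconv : Convex ℝ Y) (hcomp : IsCompact Y)
    (hne : Y.Nonempty) (S : Y → Vec d) {ε : ℝ} (hε : 0 < ε) :
    ∃ D : StdSimplex ℝ Y, SolvesEVI S ε D := by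
  -- With this encoding ⟪S p, p - y⟫ = `f y (g p)` is linear in `g p`, so only continuity in y and
  -- in c matters, never that of S.
  let g : Y → Vec d × ℝ := fun p => (S p, ⟪S p, (p : Vec d)⟫_ℝ)
  let f : Vec d → Vec d × ℝ → ℝ := fun y c => c.2 - ⟪c.1, y⟫_ℝ
  have hf_left : ∀ c, Continuous fun y => f y c := fun c => by fun_prop
  have hf_right : ∀ y, Continuous (f y) := fun y => by fun_prop
  have hf_convex : ∀ c, ConvexOn ℝ Y fun y => f y c := fun c =>
    ⟨hconv, fun y _ z _ a b _ _ hab => le_of_eq <| by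
      obtain rfl := eq_sub_of_add_eq hab
      simp only [f, inner_add_right, inner_smul_right, smul_eq_mul]
      ring⟩
  have hf_concave : ∀ y, ConcaveOn ℝ (Set.range fun D : StdSimplex ℝ Y => expect D g) (f y) :=
    fun y => ⟨convex_range_expect g, fun c _ c' _ a b _ _ _ => le_of_eq <| by
      simp only [f, Prod.fst_add, Prod.snd_add, Prod.smul_fst, Prod.smul_snd, inner_add_left,
        real_inner_smul_left, smul_eq_mul]
      ring⟩
  have hf_self : ∀ p : Y, f p (g p) = 0 := fun p => sub_self _
  -- The reply p = y has payoff 0 > -ε, and still beats -ε near y; compactness leaves finitely many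
  -- replies.
  obtain ⟨s, hs⟩ := hcomp.elim_finite_subcover (fun p : Y => {y | -ε < f y (g p)})
    (fun p => isOpen_lt continuous_const (hf_left _))
    fun y hy => Set.mem_iUnion.2 ⟨⟨y, hy⟩, by
      simpa [hf_self ⟨y, hy⟩] using hε⟩
  obtain ⟨_, ⟨D, rfl⟩, hD⟩ := Sion.exists_lt_iInf_of_lt_iInf_of_finite hne hcomp
    (Y := Set.range fun D : StdSimplex ℝ Y => expect D g) (f := f)
    (fun c _ => (hf_left c).lowerSemicontinuous.lowerSemicontinuousOn _)
    (fun c _ => (hf_convex c).quasiconvexOn)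
    (convex_range_expect g)
    (fun y _ => (hf_right y).upperSemicontinuous.upperSemicontinuousOn _)
    (fun y _ => (hf_concave y).quasiconcaveOn)
    hconv (s := g '' s) (s.finite_toSet.image g)
    (by
      rintro _ ⟨p, -, rfl⟩
      exact ⟨StdSimplex.single p, expect_single p g⟩)
    (t := -ε)
    (fun y hy => by
      obtain ⟨p, hp, hyp⟩ := Set.mem_iUnion₂.1 (hs hy)
      exact ⟨g p, Set.mem_image_of_mem g hp, hyp⟩)
  refine ⟨D, fun y => ?_⟩
  let T : Vec d × ℝ →ₗ[ℝ] ℝ :=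
    (innerₗ (Vec d) (y : Vec d)).comp (LinearMap.fst ℝ _ _) - LinearMap.snd ℝ _ _
  have hT : T (expect D g) = expect D fun p : Y => ⟪S p, (y : Vec d) - (p : Vec d)⟫_ℝ := by
    rw [map_expect]
    congr 1
    ext p
    simp [T, g, inner_sub_right, real_inner_comm]
  have hyD : -ε < (expect D g).2 - ⟪(expect D g).1, (y : Vec d)⟫_ℝ := hD y y.2
  rw [← hT]
  simp only [T, LinearMap.sub_apply, LinearMap.comp_apply, LinearMap.fst_apply,
    LinearMap.snd_apply, innerₗ_apply_apply]
  rw [real_inner_comm]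
  linarith

theorem exists_isDefensiveForecasting {d : ℕ} {X : Type*} {Y : Set (Vec d)} (hconv : Convex ℝ Y)
    (hcomp : IsCompact Y) (hne : Y.Nonempty)
    (K : Matrix (X × Y) (X × Y) (Vec d →L[ℝ] Vec d)) :
    ∃ A : Forecaster X Y, IsDefensiveForecasting K A := by
  choose A hA using fun (past : List (Round X Y)) (x : X) =>
    exists_solvesEVI hconv hcomp hne (dfOperator K past x)
      (ε := 1 / (10 * ((past.length : ℝ) + 1) ^ 2)) (by positivity)
  exact ⟨A, hA⟩

@[simp]
lemma length_history {X Y : Type*} (A : Forecaster X Y) (x : ℕ → X) (y : ℕ → Y) (t : ℕ) :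
    (history A x y t).length = t := by
  induction t with
  | zero => rfl
  | succ t ih => simp [history, ih]

/-- Telescoping: 1/(10n²) ≤ 1/(5n) - 1/(5(n+1)), since n + 1 ≤ 2n for n ≥ 1. -/
lemma sum_range_error_le (T : ℕ) :
    ∑ t ∈ Finset.range T, 1 / (10 * ((t : ℝ) + 1) ^ 2) ≤ 1 / 5 - 1 / (5 * ((T : ℝ) + 1)) := by
  induction T with
  | zero => norm_num
  | succ T ih =>
    rw [Finset.sum_range_succ]
    have h : 1 / (10 * ((T : ℝ) + 1) ^ 2) ≤
        1 / (5 * ((T : ℝ) + 1)) - 1 / (5 * ((T : ℝ) + 1 + 1)) := by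
      rw [div_sub_div _ _ (by positivity) (by positivity),
        div_le_div_iff₀ (by positivity) (by positivity)]
      have hT : (0 : ℝ) ≤ T := T.cast_nonneg
      nlinarith [mul_nonneg hT hT, mul_nonneg hT (mul_nonneg hT hT)]
    push_cast
    linarith

/-! ### Defensive Forecasting in feature space -/

section Features

variable {d : ℕ} {X F : Type*} {Y : Set (Vec d)} [NormedAddCommGroup F] [InnerProductSpace ℝ F]

/-- The sum of the expected residuals of the rounds `past`, lifted by the feature maps `Ψ`. -/
noncomputable def liftedResidual (Ψ : X × Y → Vec d →ₗ[ℝ] F) (past : List (Round X Y)) : F :=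
  (past.map fun r =>
    expect r.forecast fun q : Y => Ψ (r.context, q) ((r.outcome : Vec d) - (q : Vec d))).sum

/-- Kernel trick: the operator depends on the past only through one vector of the feature space. -/
lemma inner_dfOperator {K : Matrix (X × Y) (X × Y) (Vec d →L[ℝ] Vec d)}
    {Ψ : X × Y → Vec d →ₗ[ℝ] F} (hΨ : ∀ a b u v, ⟪u, K a b v⟫_ℝ = ⟪Ψ a u, Ψ b v⟫_ℝ)
    (past : List (Round X Y)) (x : X) (p : Y) (v : Vec d) :
    ⟪v, dfOperator K past x p⟫_ℝ = ⟪Ψ (x, p) v, liftedResidual Ψ past⟫_ℝ := by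
  unfold dfOperator liftedResidual
  induction past with
  | nil => simp
  | cons r past ih => simp only [List.map_cons, List.sum_cons, inner_add_right, ih, inner_expect, hΨ]

lemma liftedResidual_history_succ (Ψ : X × Y → Vec d →ₗ[ℝ] F) (A : Forecaster X Y)
    (x : ℕ → X) (y : ℕ → Y) (t : ℕ) :
    liftedResidual Ψ (history A x y (t + 1)) = liftedResidual Ψ (history A x y t) +
      expect (forecastAt A x y t) fun q : Y => Ψ (x t, q) ((y t : Vec d) - (q : Vec d)) := by
  simp [liftedResidual, history, forecastAt]

/-- The guarantee of Defensive Forecasting, for a kernel given by feature maps. -/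
theorem norm_liftedResidual_sq_le {K : Matrix (X × Y) (X × Y) (Vec d →L[ℝ] Vec d)}
    {Ψ : X × Y → Vec d →ₗ[ℝ] F} (hΨ : ∀ a b u v, ⟪u, K a b v⟫_ℝ = ⟪Ψ a u, Ψ b v⟫_ℝ)
    {A : Forecaster X Y} (hA : IsDefensiveForecasting K A) (x : ℕ → X) (y : ℕ → Y) (T : ℕ) :
    ‖liftedResidual Ψ (history A x y T)‖ ^ 2 ≤
      kernelVariation K (forecastAt A x y) x y T +
        2 * ∑ t ∈ Finset.range T, 1 / (10 * ((t : ℝ) + 1) ^ 2) := by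
  induction T with
  | zero => simp [liftedResidual, history, kernelVariation]
  | succ T ih =>
    set G := liftedResidual Ψ (history A x y T) with hG
    have hcross : ⟪G, expect (forecastAt A x y T) fun q : Y =>
        Ψ (x T, q) ((y T : Vec d) - (q : Vec d))⟫_ℝ ≤ 1 / (10 * ((T : ℝ) + 1) ^ 2) := by
      have := hA (history A x y T) (x T) (y T)
      rw [length_history] at this
      refine le_of_eq_of_le ?_ this
      rw [inner_expect]
      unfold forecastAt
      congr 1
      ext q
      rw [real_inner_comm, hG, ← inner_dfOperator hΨ, real_inner_comm]
    have hsq : ‖expect (forecastAt A x y T) fun q : Y =>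
        Ψ (x T, q) ((y T : Vec d) - (q : Vec d))‖ ^ 2 ≤
        expect (forecastAt A x y T) fun p : Y =>
          ⟪(p : Vec d) - (y T : Vec d), K (x T, p) (x T, p) ((p : Vec d) - (y T : Vec d))⟫_ℝ := by
      refine (norm_expect_sq_le _ _).trans_eq ?_
      congr 1
      ext p
      rw [hΨ, real_inner_self_eq_norm_sq, ← neg_sub (p : Vec d), map_neg, norm_neg]
    have hV : kernelVariation K (forecastAt A x y) x y (T + 1) =
        kernelVariation K (forecastAt A x y) x y T + expect (forecastAt A x y T) fun p : Y =>
          ⟪(p : Vec d) - (y T : Vec d), K (x T, p) (x T, p) ((p : Vec d) - (y T : Vec d))⟫_ℝ :=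
      Finset.sum_range_succ _ _
    rw [liftedResidual_history_succ, norm_add_sq_real, hV, Finset.sum_range_succ]
    linarith

end Features

/-! ### The kernel Γ' and the regret bound -/

section RKHS

variable {d : ℕ} {X : Type*} {Z L : Set (Vec d)} {H : Type*} [NormedAddCommGroup H]
  [InnerProductSpace ℝ H] [CompleteSpace H] [RKHS ℝ H (X × Z) (Vec d)]

variable (H) in
/-- The feature maps of `forecastKernel`, with values in `ℝ ⊕ H`. -/
noncomputable def forecastFeature (σ : L → Z) (a : X × L) : Vec d →ₗ[ℝ] WithLp 2 (ℝ × H) :=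
  (WithLp.linearEquiv 2 ℝ (ℝ × H)).symm.toLinearMap ∘ₗ
    (innerₗ (Vec d) (σ a.2 : Vec d)).prod (RKHS.kerFun H (a.1, σ a.2)).toLinearMap

lemma inner_forecastKernel (σ : L → Z) (a b : X × L) (u v : Vec d) :
    ⟪u, forecastKernel H σ a b v⟫_ℝ = ⟪forecastFeature H σ a u, forecastFeature H σ b v⟫_ℝ := by
  have h : ⟪u, RKHS.kernel H (a.1, σ a.2) (b.1, σ b.2) v⟫_ℝ =
      ⟪RKHS.kerFun H (a.1, σ a.2) u, RKHS.kerFun H (b.1, σ b.2) v⟫_ℝ := by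
    rw [real_inner_comm, RKHS.kernel_inner, real_inner_comm]
  simp [forecastKernel, forecastFeature, WithLp.prod_inner_apply, inner_add_right,
    inner_smul_right, real_inner_comm, h, -RKHS.kerFun_inner, -RKHS.inner_kerFun]

lemma inner_forecastFeature (σ : L → Z) (φ : H) (a : X × L) (v : Vec d) :
    ⟪WithLp.toLp 2 ((1 : ℝ), -φ), forecastFeature H σ a v⟫_ℝ =
      ⟪v, (σ a.2 : Vec d) - φ (a.1, σ a.2)⟫_ℝ := by
  rw [inner_sub_right, sub_eq_add_neg]
  simp [forecastFeature, WithLp.prod_inner_apply, real_inner_comm]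

/-- The regret is at most the correlation of the lifted residuals with `(1, -φ)`. -/
lemma contextualRegret_le_inner {σ : L → Z} (hσ : IsBestResponse σ) (A : Forecaster X L)
    (x : ℕ → X) (ℓ : ℕ → L) (T : ℕ) {φ : H} (hφ : φ ∈ endomorphisms H) :
    contextualRegret (play σ A x ℓ) x ℓ T φ ≤
      ⟪WithLp.toLp 2 ((1 : ℝ), -φ),
        liftedResidual (forecastFeature H σ) (history A x ℓ T)⟫_ℝ := by
  induction T with
  | zero => simp [contextualRegret, liftedResidual, history]
  | succ T ih =>
    rw [contextualRegret, Finset.sum_range_succ, liftedResidual_history_succ, inner_add_right]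
    refine add_le_add ih ?_
    rw [play, expect_map, inner_expect]
    refine expect_mono _ fun p => ?_
    rw [inner_forecastFeature, inner_sub_left]
    -- φ(x, σ(p)) lies in Z, so it is a competitor of σ(p).
    have h := hσ p ⟨φ (x T, σ p), hφ (x T) (σ p)⟩
    rw [inner_sub_right (p : Vec d)]
    simp only at h ⊢
    linarith

theorem contextualRegret_le {σ : L → Z} (hσ : IsBestResponse σ)
    (hρ : BddAbove ((fun φ : H => ‖φ‖) '' endomorphisms H)) {A : Forecaster X L}
    (hA : IsDefensiveForecasting (forecastKernel H σ) A) (x : ℕ → X) (ℓ : ℕ → L) (T : ℕ)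
    {φ : H} (hφ : φ ∈ endomorphisms H) :
    contextualRegret (play σ A x ℓ) x ℓ T φ ≤ √(1 + endomorphismRadius H ^ 2) *
      √(kernelVariation (forecastKernel H σ) (forecastAt A x ℓ) x ℓ T + 1) := by
  refine (contextualRegret_le_inner hσ A x ℓ T hφ).trans ((real_inner_le_norm _ _).trans ?_)
  -- Boundedness is essential here: `sSup` of an unbounded set of reals is 0 by default.
  have hφρ : ‖φ‖ ≤ endomorphismRadius H := le_csSup hρ (Set.mem_image_of_mem _ hφ)
  refine mul_le_mul ?_ (Real.le_sqrt_of_sq_le ?_) (norm_nonneg _) (Real.sqrt_nonneg _)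
  · refine Real.le_sqrt_of_sq_le ?_
    rw [WithLp.prod_norm_sq_eq_of_L2]
    change ‖(1 : ℝ)‖ ^ 2 + ‖-φ‖ ^ 2 ≤ _
    rw [norm_one, norm_neg, one_pow]
    gcongr
  -- The errors contribute at most 2 · 1/5 ≤ 1.
  · refine (norm_liftedResidual_sq_le (inner_forecastKernel σ) hA x ℓ T).trans ?_
    have h := sum_range_error_le T
    have : 0 ≤ 1 / (5 * ((T : ℝ) + 1)) := by positivity
    linarith

end RKHS

/-- Each factor loses √2, from 1 + ρ² ≤ 2ρ² and V + 1 ≤ 2V. -/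
lemma sqrt_mul_sqrt_le_two_mul {ρ V : ℝ} (hρ : 1 ≤ ρ) (hV : 1 ≤ V) :
    √(1 + ρ ^ 2) * √(V + 1) ≤ 2 * ρ * √V := by
  have h1 : √(1 + ρ ^ 2) ≤ √2 * ρ :=
    Real.sqrt_le_iff.2 ⟨by positivity, by
      rw [mul_pow, Real.sq_sqrt zero_le_two]; nlinarith⟩
  have h2 : √(V + 1) ≤ √2 * √V := by
    rw [← Real.sqrt_mul zero_le_two]
    exact Real.sqrt_le_sqrt (by linarith)
  calc √(1 + ρ ^ 2) * √(V + 1) ≤ (√2 * ρ) * (√2 * √V) := by gcongr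
    _ = (√2 * √2) * ρ * √V := by ring
    _ = 2 * ρ * √V := by rw [Real.mul_self_sqrt zero_le_two]

end PhiRegret

theorem mainTheorem5 {d : ℕ} {X : Type*} {Z L : Set (PhiRegret.Vec d)}
    (hZconv : Convex ℝ Z) (hZcomp : IsCompact Z)
    (hLconv : Convex ℝ L) (hLcomp : IsCompact L) (hLne : L.Nonempty)
    (σ : L → Z) (hσ : PhiRegret.IsBestResponse σ)
    (H : Type*) [NormedAddCommGroup H] [InnerProductSpace ℝ H] [CompleteSpace H]
    [RKHS ℝ H (X × Z) (PhiRegret.Vec d)]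
    (hρ : BddAbove ((fun φ : H => ‖φ‖) '' PhiRegret.endomorphisms H)) :
    (∃ A : PhiRegret.Forecaster X L,
      PhiRegret.IsDefensiveForecasting (PhiRegret.forecastKernel H σ) A) ∧
    ∀ A : PhiRegret.Forecaster X L,
      PhiRegret.IsDefensiveForecasting (PhiRegret.forecastKernel H σ) A →
      ∀ (x : ℕ → X) (ℓ : ℕ → L) (T : ℕ) (ρ V : ℝ),
        ρ = PhiRegret.endomorphismRadius H →
        V = PhiRegret.kernelVariation (PhiRegret.forecastKernel H σ)
          (PhiRegret.forecastAt A x ℓ) x ℓ T →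
        PhiRegret.phiRegret H (PhiRegret.play σ A x ℓ) x ℓ T ≤
            ((Real.sqrt (1 + ρ ^ 2) * Real.sqrt (V + 1) : ℝ) : EReal) ∧
        (1 ≤ ρ → 1 ≤ V →
          PhiRegret.phiRegret H (PhiRegret.play σ A x ℓ) x ℓ T ≤
            ((2 * ρ * Real.sqrt V : ℝ) : EReal)) := by

  refine ⟨PhiRegret.exists_isDefensiveForecasting hLconv hLcomp hLne _, ?_⟩
  rintro A hA x ℓ T _ _ rfl rfl
  have h := fun φ (hφ : φ ∈ PhiRegret.endomorphisms H) =>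
    PhiRegret.contextualRegret_le hσ hρ hA x ℓ T hφ
  exact ⟨iSup₂_le fun φ hφ => EReal.coe_le_coe_iff.2 (h φ hφ), fun hρ1 hV1 =>
    iSup₂_le fun φ hφ => EReal.coe_le_coe_iff.2
      ((h φ hφ).trans (PhiRegret.sqrt_mul_sqrt_le_two_mul hρ1 hV1))⟩
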